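/- A deterministic one-tape Turing machine is a tuple $(Q,\Sigma,\Gamma,\delta,q_0,F)$, where $Q$ is a finite set of states, $\Sigma$ is the finite input alphabet, $\Gamma\supseteq\Sigma$ is the finite working alphabet, which also contains a blank symbol $\flat\notin\Sigma$, $q_0\in Q$ is the initial state, $F\subseteq Q$ is the set of final states, and $\delta\colon Q\times\Gamma\to Q\times(\Gamma\setminus\{\flat\})\times\{-1,+1\}$ is a partial function. If $\delta(p,\sigma)=(q,\tau,d)$, then the machine, in state $p$ with the head scanning $\sigma$, enters state $q$, overwrites $\sigma$ by $\tau$, and moves its head one cell to the left ($d=-1$) or to the right ($d=+1$); it halts when no transition applies. The tape is bi-infinite. On input $w\in\Sigma^*$ the machine starts in state $q_0$, with $w$ written on a segment of the tape, all other cells blank, and the head on the leftmost symbol of $w$ (on a blank cell if $w$ is empty). The input is accepted if the machine eventually halts in a final state. The machine is weight-reducing if there is a partial order $<$ on $\Gamma$ such that $\delta(p,\sigma)=(q,\tau,d)$ always implies $\tau<\sigma$. (A weight-reducing machine need not halt on every input.) Let $\Sigma$ be a finite alphabet. A language $L\subseteq\Sigma^*$ is regular, i.e. accepted by some finite automaton,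 if and only if there is a weight-reducing deterministic one-tape Turing machine with input alphabet $\Sigma$ that accepts exactly the language $L$. -/

import Mathlib

universe u v w

/-- A deterministic one-tape Turing machine over the input alphabet `Sig`: finite sets of states and
of working symbols, the input symbols being (via `embed`) working symbols other than the blank, and a
partial transition function that never writes the blank. Partiality is expressed by `Option`. -/
structure OneTapeDTM (Sig : Type u) where
  State : Type v
  Symbol : Type w
  finite_state : Finite State
  finite_symbol : Finite Symbol
  embed : Sig ↪ Symbol
  blank : Symbol
  embed_ne_blank : ∀ a : Sig, embed a ≠ blank
  delta : State → Symbol → Option (State × {t : Symbol // t ≠ blank} × Turing.Dir)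
  start : State
  final : Set State

namespace OneTapeDTM

variable {Sig : Type u} (M : OneTapeDTM.{u, v, w} Sig)

/-- A configuration: current state, contents of the bi-infinite tape, position of the head. -/
structure Config where
  state : M.State
  tape : ℤ → M.Symbol
  head : ℤ

/-- The position of the head after a move from position `i` in the given direction. -/
def move (i : ℤ) : Turing.Dir → ℤ
  | Turing.Dir.left => i - 1
  | Turing.Dir.right => i + 1

/-- One step of the machine: `none` if no transition can be applied. -/
def step (c : M.Config) : Option M.Config :=
  match M.delta c.state (c.tape c.head) with
  | none => none
  | some (q, t, d) => some ⟨q, Function.update c.tape c.head t.1, move c.head d⟩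

/-- `c'` is a successor of `c`. -/
def Yields (c c' : M.Config) : Prop := M.step c = some c'

/-- A halting configuration is one without successor. -/
def IsHalting (c : M.Config) : Prop := ∀ c' : M.Config, ¬ M.Yields c c'

/-- The initial tape: the input `x` in the cells `0, …, |x| - 1`, blanks elsewhere. -/
def initTape (x : List Sig) : ℤ → M.Symbol
  | Int.ofNat n => (x.map M.embed).getD n M.blank
  | Int.negSucc _ => M.blank

/-- The initial configuration: initial state, head on cell `0`, which holds the leftmost input
symbol, or the blank if the input is empty. -/
def initConfig (x : List Sig) : M.Config := ⟨M.start, M.initTape x, 0⟩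

/-- The accepted language: inputs on which the machine eventually halts in a final state. -/
def language : Language Sig :=
  {x | ∃ c : M.Config,
    Relation.ReflTransGen M.Yields (M.initConfig x) c ∧ M.IsHalting c ∧ c.state ∈ M.final}

/-- Weight-reducing machines: for some partial order on the working alphabet, every transition
replaces the scanned symbol by a strictly smaller one. -/
def IsWeightReducing : Prop :=
  ∃ _ : PartialOrder M.Symbol, ∀ (p : M.State) (s : M.Symbol) (q : M.State)
    (t : {t : M.Symbol // t ≠ M.blank}) (d : Turing.Dir),
      M.delta p s = some (q, t, d) → t.1 < s

end OneTapeDTM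

/-! For regularity, cut the tape between a prefix `x` and the rest of the input, and record the
states in which an accepting computation crosses the cut. Each crossing lowers the rank of one of
the two cells at the cut and ranks never rise, so the record has bounded length
(`Crossing.length_le`). Accepting computations with equal records can be recombined across the cut
(`Crossing.accepts_glue`). Hence the left quotient by `x` depends only on the set of records
possible at the end of `x` and on whether `x` is empty: there are finitely many left quotients, and
Myhill–Nerode applies. Conversely, a finite automaton is simulated in a single sweep to the right
(`scanner`). -/

namespace OneTapeDTM

/-! ### Steps, acceptance and translation invariance -/

section Acceptance

variable {Sig : Type u} {M : OneTapeDTM.{u, v, w} Sig}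

theorem yields_iff {c c' : M.Config} :
    M.Yields c c' ↔ ∃ q t d, M.delta c.state (c.tape c.head) = some (q, t, d) ∧
      c' = ⟨q, Function.update c.tape c.head t.1, move c.head d⟩ := by
  unfold Yields step
  rcases M.delta c.state (c.tape c.head) with _ | ⟨q, t, d⟩
  · simp
  · constructor
    · intro h
      exact ⟨q, t, d, rfl, (Option.some.inj h).symm⟩
    · rintro ⟨q', t', d', h, rfl⟩
      cases h
      rfl

theorem isHalting_iff {c : M.Config} :
    M.IsHalting c ↔ M.delta c.state (c.tape c.head) = none := by
  unfold IsHalting Yields step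
  rcases M.delta c.state (c.tape c.head) with _ | ⟨q, t, d⟩ <;> simp

variable (M) in
/-- The computation starting in `c` halts in a final state. -/
def Accepts (c : M.Config) : Prop :=
  ∃ c' : M.Config, Relation.ReflTransGen M.Yields c c' ∧ M.IsHalting c' ∧ c'.state ∈ M.final

theorem Accepts.head {c c' : M.Config} (h : M.Yields c c') (h' : M.Accepts c') : M.Accepts c := by
  obtain ⟨d, hd, hh⟩ := h'
  exact ⟨d, .head h hd, hh⟩

theorem mem_language {x : List Sig} : x ∈ M.language ↔ M.Accepts (M.initConfig x) := Iff.rfl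

/-- The configuration seen from a coordinate system with origin at cell `k`. -/
def Config.shift (k : ℤ) (c : M.Config) : M.Config :=
  ⟨c.state, fun i => c.tape (i + k), c.head - k⟩

theorem Yields.shift {c c' : M.Config} (k : ℤ) (h : M.Yields c c') :
    M.Yields (c.shift k) (c'.shift k) := by
  obtain ⟨q, t, d, hd, rfl⟩ := yields_iff.1 h
  refine yields_iff.2 ⟨q, t, d, by simpa [Config.shift] using hd, ?_⟩
  simp only [Config.shift, Config.mk.injEq, true_and]
  constructor
  · funext i
    simp only [Function.update_apply]
    congr 1
    exact propext ⟨fun h => by omega, fun h => by omega⟩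
  · cases d <;> simp only [move] <;> omega

theorem Accepts.shift {c : M.Config} (k : ℤ) (h : M.Accepts c) : M.Accepts (c.shift k) := by
  obtain ⟨d, hd, hh, hf⟩ := h
  refine ⟨d.shift k, Relation.ReflTransGen.lift (Config.shift k) (fun _ _ => Yields.shift k) _ _ hd, ?_, hf⟩
  rw [isHalting_iff] at hh ⊢
  simpa [Config.shift] using hh

theorem accepts_shift_iff {c : M.Config} (k : ℤ) : M.Accepts (c.shift k) ↔ M.Accepts c := by
  refine ⟨fun h => ?_, .shift k⟩
  simpa [Config.shift] using h.shift (-k)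

end Acceptance

/-! ### Crossing sequences: length bound and cut-and-paste -/

section CrossingSequences

variable {Sig : Type u} {M : OneTapeDTM.{u, v, w} Sig}

/-- The side of the boundary between the cells `-1` and `0` on which a cell lies: `true` for
left, `false` for right. -/
def side (i : ℤ) : Bool := decide (i < 0)

variable (M) in
/-- `M.Crossing n c s`: the computation from `c` halts in a final state after `n` steps, and `s`
lists the states in which it enters a cell by crossing the boundary between `-1` and `0`. -/
inductive Crossing : ℕ → M.Config → List M.State → Prop
  | halt {c : M.Config} : M.IsHalting c → c.state ∈ M.final → Crossing 0 c []
  | stay {n : ℕ} {c c' : M.Config} {s : List M.State} : M.Yields c c' →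
      side c'.head = side c.head → Crossing n c' s → Crossing (n + 1) c s
  | cross {n : ℕ} {c c' : M.Config} {s : List M.State} : M.Yields c c' →
      side c'.head = !side c.head → Crossing n c' s → Crossing (n + 1) c (c'.state :: s)

theorem Accepts.exists_crossing {c : M.Config} (h : M.Accepts c) : ∃ n s, M.Crossing n c s := by
  obtain ⟨d, hd, hh, hf⟩ := h
  induction hd using Relation.ReflTransGen.head_induction_on with
  | refl => exact ⟨0, [], .halt hh hf⟩
  | @head a b hab _ ih =>
    obtain ⟨n, s, hs⟩ := ih
    by_cases hside : side b.head = side a.head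
    · exact ⟨n + 1, s, .stay hab hside hs⟩
    · exact ⟨n + 1, b.state :: s, .cross hab (Bool.eq_not_of_ne hside) hs⟩

theorem side_move {i : ℤ} {d : Turing.Dir} (h : side (move i d) = !side i) :
    i = (if side i then -1 else 0) ∧ move i d = (if side i then 0 else -1) := by
  have h' : move i d < 0 ↔ ¬ i < 0 := by
    rw [side, side, ← decide_not, decide_eq_decide] at h
    exact h
  simp only [side, decide_eq_true_eq]
  cases d <;> simp only [move] at h' ⊢ <;> split_ifs <;> omega

theorem Crossing.accepts {n : ℕ} {c : M.Config} {s : List M.State} (h : M.Crossing n c s) :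
    M.Accepts c := by
  induction h with
  | halt hh hf => exact ⟨_, .refl, hh, hf⟩
  | stay hy _ _ ih => exact ih.head hy
  | cross hy _ _ ih => exact ih.head hy

/-- If the rank of the scanned symbol drops in each step, the crossing sequence is no longer than
the ranks of the two cells at the boundary allow. -/
theorem Crossing.length_le {rank : M.Symbol → ℕ}
    (hrank : ∀ p s q t d, M.delta p s = some (q, t, d) → rank t.1 < rank s)
    {n : ℕ} {c : M.Config} {s : List M.State} (h : M.Crossing n c s) :
    s.length ≤ rank (c.tape (-1)) + rank (c.tape 0) := by
  induction h with
  | halt => simp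
  | @stay n c c' s hy _ _ ih =>
    obtain ⟨q, t, d, hd, rfl⟩ := yields_iff.1 hy
    have hlt := hrank _ _ _ _ _ hd
    have key : ∀ i, rank (Function.update c.tape c.head t.1 i) ≤ rank (c.tape i) := by
      intro i
      rcases eq_or_ne i c.head with rfl | hi
      · simpa using hlt.le
      · simp [hi]
    exact ih.trans (add_le_add (key _) (key _))
  | @cross n c c' s hy hside _ ih =>
    obtain ⟨q, t, d, hd, rfl⟩ := yields_iff.1 hy
    have hlt := hrank _ _ _ _ _ hd
    -- A crossing step rewrites cell `-1` or cell `0`, and the drop in rank there pays for the new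
    -- entry.
    have hh := (side_move hside).1
    simp only [List.length_cons]
    cases hb : side c.head <;> simp only [hb] at hh <;> simp at hh <;> rw [hh] at ih hlt <;>
      simp at ih <;> omega

/-- The configuration with the state and head of `a`, the tape of `a` on side `β` and that of `b`
on the other side. -/
def glue (β : Bool) (a b : M.Config) : M.Config :=
  ⟨a.state, fun i => if side i = β then a.tape i else b.tape i, a.head⟩

/-- A step reads and writes only the scanned cell, which lies on side `β`, so the other half of the
tape is irrelevant. -/
theorem yields_glue {β : Bool} {a a' : M.Config} (b : M.Config) (ha : side a.head = β)
    (h : M.Yields a a') :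
    M.Yields (glue β a b)
      ⟨a'.state, fun i => if side i = β then a'.tape i else b.tape i, a'.head⟩ := by
  obtain ⟨q, t, d, hd, rfl⟩ := yields_iff.1 h
  refine yields_iff.2 ⟨q, t, d, by simpa [glue, ha] using hd, ?_⟩
  simp only [glue, Config.mk.injEq, true_and, and_true]
  funext i
  rcases eq_or_ne i a.head with rfl | hi
  · simp [ha]
  · simp [hi]

theorem Yields.tape_eq {a a' : M.Config} (h : M.Yields a a') {i : ℤ} (hi : side i ≠ side a.head) :
    a'.tape i = a.tape i := by
  obtain ⟨q, t, d, -, rfl⟩ := yields_iff.1 h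
  exact Function.update_of_ne (fun h => hi (by rw [h])) _ _

/-- After crossing the boundary, the position of the head depends only on the direction. -/
theorem Yields.head_eq {a a' : M.Config} (h : M.Yields a a') (hs : side a'.head = !side a.head) :
    a'.head = if side a.head then 0 else -1 := by
  obtain ⟨q, t, d, -, rfl⟩ := yields_iff.1 h
  exact (side_move hs).2

/-- Cut and paste: two accepting computations with the same crossing sequence can be combined. -/
theorem Crossing.accepts_glue {β : Bool} {m n : ℕ} {a b : M.Config} {s : List M.State}
    (ha : M.Crossing m a s) (hb : M.Crossing n b s) (hsa : side a.head = β)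
    (hsb : side b.head = β) : M.Accepts (glue β a b) := by
  induction hN : m + n using Nat.strong_induction_on generalizing β m n a b s with
  | _ N ih =>
    subst hN
    cases ha with
    | halt hh hf =>
      refine ⟨_, .refl, ?_, hf⟩
      rw [isHalting_iff] at hh ⊢
      simpa [glue, hsa] using hh
    | @stay m _ a' _ hy hside h =>
      exact (ih (m + n) (by omega) h hb (hside.trans hsa) hsb rfl).head (yields_glue b hsa hy)
    | @cross m _ a' s hy hside h =>
      generalize hs : a'.state :: s = l at hb
      cases hb with
      | halt => cases hs
      | @stay n _ b' _ hyb hsideb hb =>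
        subst hs
        -- Only `b` advances: it writes on side `β`, where the glued tape shows `a`, so the glued
        -- configuration is unchanged.
        have := ih (m + 1 + n) (by omega) (.cross hy hside h) hb hsa (hsideb.trans hsb) rfl
        convert this using 1
        simp only [glue, Config.mk.injEq, true_and, and_true]
        funext i
        split_ifs with hi
        · rfl
        · exact (hyb.tape_eq (hsb ▸ hi)).symm
      | @cross n _ b' _ hyb hsideb hb =>
        obtain ⟨hq, rfl⟩ := List.cons.inj hs
        -- Both computations enter the same cell in the same state, so `b` now drives the glued
        -- computation, on the opposite side.
        have := ih (n + m) (by omega) (β := !β) hb h (hsideb.trans (by rw [hsb]))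
          (hside.trans (by rw [hsa])) rfl
        refine this.head ?_
        convert yields_glue b hsa hy using 1
        simp only [glue, Config.mk.injEq]
        refine ⟨hq.symm, ?_, ?_⟩
        · funext i
          by_cases hi : side i = β
          · simp [hi]
          · rw [if_pos (Bool.eq_not_of_ne hi), if_neg hi]
            exact hyb.tape_eq (hsb ▸ hi)
        · rw [hy.head_eq hside, hyb.head_eq hsideb, hsa, hsb]

end CrossingSequences

/-! ### Finitely many left quotients -/

section Regularity

variable {Sig : Type u} (M : OneTapeDTM.{u, v, w} Sig)

/-- The initial configuration on `x ++ y`, in coordinates where `y` starts at cell `0`. -/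
def splitConfig (x y : List Sig) : M.Config := (M.initConfig (x ++ y)).shift x.length

theorem append_mem_language {x y : List Sig} :
    x ++ y ∈ M.language ↔ M.Accepts (M.splitConfig x y) :=
  mem_language.trans (accepts_shift_iff _).symm

theorem initTape_natCast (x : List Sig) (n : ℕ) :
    M.initTape x n = (x.map M.embed).getD n M.blank := rfl

theorem splitConfig_tape_left (x y y' : List Sig) {i : ℤ} (hi : i < 0) :
    (M.splitConfig x y).tape i = (M.splitConfig x y').tape i := by
  change M.initTape _ (i + x.length) = M.initTape _ (i + x.length)
  rcases h : i + (x.length : ℤ) with n | n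
  · have hn : n < x.length := by
      have : ((n : ℕ) : ℤ) = i + x.length := h.symm
      omega
    simp [initTape, List.getElem?_append_left, hn]
  · rfl

theorem splitConfig_tape_right (x y : List Sig) {i : ℤ} (hi : 0 ≤ i) :
    (M.splitConfig x y).tape i = M.initTape y i := by
  lift i to ℕ using hi
  change M.initTape _ ((i : ℤ) + x.length) = _
  rw [← Nat.cast_add, initTape_natCast, initTape_natCast]
  simp [List.getElem?_append_right]

theorem side_splitConfig_head (x y : List Sig) :
    side (M.splitConfig x y).head = decide (x ≠ []) := by
  have h : (M.splitConfig x y).head = -(x.length : ℤ) := by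
    simp [splitConfig, initConfig, Config.shift]
  rw [h, side]
  cases x with
  | nil => simp
  | cons a l =>
    simp only [List.length_cons]
    simp
    omega

/-- The crossing sequences, of length at most `K`, at the end of the prefix `x` of accepted words. -/
def prefixCrossings (K : ℕ) (x : List Sig) : Set {s : List M.State // s.length ≤ K} :=
  {s | ∃ n y, M.Crossing n (M.splitConfig x y) s.1}

/-- Left of the cut the tape depends only on the prefix, right of it only on the suffix. Emptiness
of the prefix decides on which side the head starts, and gluing needs a common side. -/
theorem mem_language_of_crossing {m n : ℕ} {x x' y y' : List Sig} {s : List M.State}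
    (hx : x = [] ↔ x' = []) (h : M.Crossing m (M.splitConfig x y) s)
    (h' : M.Crossing n (M.splitConfig x' y') s) : x ++ y' ∈ M.language := by
  rw [append_mem_language]
  by_cases hnil : x = []
  · obtain rfl := hx.1 hnil
    exact hnil ▸ h'.accepts
  · have hnil' : x' ≠ [] := fun h => hnil (hx.2 h)
    have := h.accepts_glue h' (β := true) (by simp [side_splitConfig_head, hnil])
      (by simp [side_splitConfig_head, hnil'])
    convert this using 1
    simp only [glue, splitConfig, Config.shift, initConfig, Config.mk.injEq, true_and, and_true]
    funext i
    by_cases hi : i < 0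
    · simp only [side, hi, decide_true, if_true]
      exact M.splitConfig_tape_left x y' y hi
    · have h0 : 0 ≤ i := not_lt.1 hi
      simp only [side, hi, decide_false, Bool.false_eq_true, if_false]
      exact (M.splitConfig_tape_right x y' h0).trans
        (M.splitConfig_tape_right x' y' h0).symm

variable {M}

/-- The rank of a symbol is the number of symbols strictly below it. -/
theorem IsWeightReducing.exists_rank (h : M.IsWeightReducing) :
    ∃ rank : M.Symbol → ℕ,
      ∀ p s q t d, M.delta p s = some (q, t, d) → rank t.1 < rank s := by
  obtain ⟨_, h⟩ := h
  have := M.finite_symbol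
  exact ⟨fun s => (Set.Iio s).ncard, fun p s q t d hd =>
    Set.ncard_lt_ncard (Set.Iio_ssubset_Iio (h p s q t d hd)) (Set.toFinite _)⟩

theorem IsWeightReducing.isRegular_language (h : M.IsWeightReducing) : M.language.IsRegular := by
  obtain ⟨rank, hrank⟩ := h.exists_rank
  have := M.finite_symbol
  have := M.finite_state
  obtain ⟨B, hB⟩ := (Set.finite_range rank).bddAbove
  have hlen {n c s} (hs : M.Crossing n c s) : s.length ≤ B + B :=
    (hs.length_le hrank).trans (add_le_add (hB ⟨_, rfl⟩) (hB ⟨_, rfl⟩))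
  have : Finite {s : List M.State // s.length ≤ B + B} := List.finite_length_le _ _
  -- An invariant with finite codomain that determines the left quotient.
  let f (x : List Sig) : Prop × Set {s : List M.State // s.length ≤ B + B} :=
    (x = [], M.prefixCrossings (B + B) x)
  have hsub {x x' : List Sig} (hf : f x = f x') {y : List Sig} (hy : x ++ y ∈ M.language) :
      x' ++ y ∈ M.language := by
    obtain ⟨n, s, hs⟩ := (M.append_mem_language.1 hy).exists_crossing
    have hmem : (⟨s, hlen hs⟩ : {s : List M.State // s.length ≤ B + B}) ∈ (f x).2 := ⟨n, y, hs⟩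
    rw [hf] at hmem
    obtain ⟨n', y', hs'⟩ := hmem
    exact M.mem_language_of_crossing (Iff.of_eq (congrArg Prod.fst hf).symm) hs' hs
  have hfac : M.language.leftQuotient.FactorsThrough f := fun x x' hf =>
    Set.ext fun y => ⟨hsub hf, hsub hf.symm⟩
  refine Language.isRegular_iff_finite_range_leftQuotient.2 ?_
  obtain ⟨g, hg⟩ := (Function.factorsThrough_iff _).1 hfac
  rw [hg]
  exact (Set.finite_range g).subset (Set.range_comp_subset_range f g)

end Regularity

/-! ### Simulating a finite automaton -/

section Scanner

variable {Sig : Type u} {n k : ℕ}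

/-- The machine that simulates a finite automaton, erasing the input from left to right by the
symbol `0`. The blank is `1`, the input symbols are `2, 3, …`. -/
def scanner (e : Sig ≃ Fin n) (A : DFA Sig (Fin k)) : OneTapeDTM.{u, v, w} Sig where
  State := ULift (Fin k)
  Symbol := ULift (Fin (n + 2))
  finite_state := inferInstance
  finite_symbol := inferInstance
  embed := ⟨fun a => ⟨(e a).succ.succ⟩, fun a b h => by simpa using h⟩
  blank := ⟨1⟩
  embed_ne_blank a h := by
    have h : (e a).succ.succ = 1 := congrArg ULift.down h
    simp [Fin.ext_iff] at h
  -- No transition on the blank: the machine halts when the input is exhausted.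
  delta p s :=
    if h : 2 ≤ s.down.val then
      some (⟨A.step p.down (e.symm ⟨s.down.val - 2, by omega⟩)⟩, ⟨⟨0⟩, fun h => by simpa using congrArg ULift.down h⟩, .right)
    else none
  start := ⟨A.start⟩
  final := {p | p.down ∈ A.accept}

variable (e : Sig ≃ Fin n) (A : DFA Sig (Fin k))

theorem scanner_isWeightReducing : (scanner.{u, v, w} e A).IsWeightReducing := by
  refine ⟨(inferInstance : PartialOrder (ULift (Fin (n + 2)))), fun p s q t d h => ?_⟩
  simp only [scanner] at h
  split_ifs at h with hs
  cases h
  change (0 : Fin (n + 2)) < s.down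
  rw [Fin.lt_def]
  simp only [Fin.val_zero]
  omega

theorem delta_scanner_embed (p : Fin k) (a : Sig) :
    (scanner.{u, v, w} e A).delta ⟨p⟩ ((scanner.{u, v, w} e A).embed a) =
      some (⟨A.step p a⟩, ⟨⟨0⟩, fun h => Fin.zero_ne_one (congrArg ULift.down h)⟩, .right) := by
  have h : 2 ≤ (e a).succ.succ.val := by simp
  simp only [scanner, Option.dite_none_right_eq_some]
  refine ⟨h, ?_⟩
  change some (ULift.up (A.step p (e.symm ⟨(e a).val + 2 - 2, _⟩)), _, _) = _
  simp

/-- The cells left of `i` are unconstrained because the head never returns to them; this lets the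
induction pass over the erased symbols. -/
theorem accepts_scanner_iff (x : List Sig) (p : Fin k) (T : ℤ → (scanner.{u, v, w} e A).Symbol)
    (i : ℤ) (hT : ∀ j : ℕ, T (i + j) =
      (x.map (scanner.{u, v, w} e A).embed).getD j (scanner.{u, v, w} e A).blank) :
    (scanner.{u, v, w} e A).Accepts ⟨⟨p⟩, T, i⟩ ↔ x ∈ A.acceptsFrom p := by
  induction x generalizing p T i with
  | nil =>
    have h0 : T i = (scanner.{u, v, w} e A).blank := by simpa using hT 0
    have hh : (scanner.{u, v, w} e A).IsHalting ⟨⟨p⟩, T, i⟩ := by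
      rw [isHalting_iff]
      simp [h0, scanner]
    constructor
    · rintro ⟨d, hd, -, hf⟩
      rcases hd.cases_head with rfl | ⟨c, hc, -⟩
      · exact hf
      · exact (hh c hc).elim
    · exact fun hf => ⟨_, .refl, hh, hf⟩
  | cons a x ih =>
    have h0 : T i = (scanner.{u, v, w} e A).embed a := by simpa using hT 0
    have hy := (yields_iff (c := (⟨⟨p⟩, T, i⟩ : (scanner.{u, v, w} e A).Config))).2 ⟨_, _, _,
      (congrArg ((scanner.{u, v, w} e A).delta ⟨p⟩) h0).trans (delta_scanner_embed e A p a), rfl⟩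
    have := ih (A.step p a) (Function.update T i (⟨0⟩ : ULift (Fin (n + 2)))) (i + 1) fun j => by
      refine (Function.update_of_ne (by omega) _ _).trans ?_
      have := hT (j + 1)
      simpa [add_assoc, add_comm (1 : ℤ)] using this
    refine Iff.trans ⟨?_, fun h => h.head hy⟩ this
    rintro ⟨d, hd, hh, hf⟩
    rcases hd.cases_head with rfl | ⟨c, hc, hcd⟩
    · exact (hh _ hy).elim
    · cases Option.some.inj (hc.symm.trans hy)
      exact ⟨d, hcd, hh, hf⟩

theorem language_scanner : (scanner.{u, v, w} e A).language = A.accepts := by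
  ext x
  rw [mem_language]
  refine accepts_scanner_iff e A x A.start _ 0 fun j => ?_
  rw [zero_add, initTape_natCast]

end Scanner

end OneTapeDTM

theorem mainTheorem9 {Sig : Type u} [Finite Sig] (L : Language Sig) :
    L.IsRegular ↔ ∃ M : OneTapeDTM.{u, v, w} Sig, M.IsWeightReducing ∧ M.language = L := by
  constructor
  · rintro ⟨σ, _, A, rfl⟩
    obtain ⟨n, ⟨e⟩⟩ := Finite.exists_equiv_fin Sig
    refine ⟨.scanner e (DFA.reindex (Fintype.equivFin σ) A),
      OneTapeDTM.scanner_isWeightReducing _ _, ?_⟩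
    rw [OneTapeDTM.language_scanner, DFA.accepts_reindex]
  · rintro ⟨M, hM, rfl⟩
    exact hM.isRegular_language
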